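/- Take the triangular lattice in the plane with vertices $a(1,0)+b(\tfrac12,\tfrac{\sqrt3}{2})$, $a,b\in\mathbb Z$, and edges of length $1$. Its lattice lines are $a=c$, $b=c$ and $a+b=c$ with $c\in\mathbb Z$. The *hexagonal dimer* (Kagome) lattice is obtained by erasing every other line in each direction, namely those with $c$ even: its vertices are the points on at least one remaining line, and its edges are the unit edges on the remaining lines. The translations preserving it are generated by $(2,0)$ and $(1,\sqrt3)$, and the centres of its small hexagons are the points with $a$ and $b$ both even. A *large hexagon* is the set of the $30$ vertices of the Kagome lattice lying in a regular hexagon of side $3$, with sides parallel to the lattice lines, centred at the centre of a small hexagon. The *tiling by large hexagons* consists of the large hexagons whose centres form a translate $c+L$ of the lattice $L$ spanned by $(6,2\sqrt3)$ and $(0,4\sqrt3)$, where $c$ is the centre of a small hexagon. Let $\mathbb H$ be a finite quotient graph of the Kagome lattice by a group $\Lambda$ of translations preserving it, and assume that $\mathbb H$ is *tileable*, i.e. that some tiling by large hexagons as above is invariant under $\Lambda$. Let $v(\mathbb H)$ be the number of vertices of $\mathbb H$, let $I(\mathbb H)$ be its independence complex (the simplicial complex whose faces are the independent sets of $\mathbb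 H$), and let $\widetilde\beta(I(\mathbb H))=\sum_{i\ge -1}\dim\widetilde H_i(I(\mathbb H);\mathbb Q)$ be its total reduced Betti number. Then $$\widetilde\beta(I(\mathbb H))\le\bigl(14^{1/36}\cdot2^{1/6}\bigr)^{v(\mathbb H)}.$$ Moreover $14^{1/36}\cdot 2^{1/6}\approx 1.21$, with an error of less than $0.005$, and $14^{1/36}\cdot 2^{1/6}<2^{1/3}$. -/

import Mathlib

/-! ### Reduced simplicial homology with rational coefficients -/

namespace PreAbstractSimplicialComplex

variable {ι : Type*}

/-- The faces of `K` with exactly `n` vertices, where the empty set counts as a face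
(so these are the faces of dimension `n - 1` of the augmented complex). -/
def augFaces (K : PreAbstractSimplicialComplex ι) (n : ℕ) : Set (Finset ι) :=
  {σ | σ.card = n ∧ (σ = ∅ ∨ σ ∈ K)}

/-- The rational augmented chains of `K` of dimension `n - 1`: formal rational combinations of the
faces with `n` vertices, each face being oriented by the order of the vertices. -/
def augChains (K : PreAbstractSimplicialComplex ι) (n : ℕ) : Submodule ℚ (Finset ι →₀ ℚ) :=
  Finsupp.supported ℚ ℚ (K.augFaces n)

/-- The simplicial boundary operator
`∂ [v₀ < ⋯ < vₖ] = ∑ⱼ (-1)ʲ [v₀ < ⋯ (omit vⱼ) ⋯ < vₖ]`, with `∂ [v] = [∅]` and `∂ [∅] = 0`. -/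
noncomputable def augBoundary (ι : Type*) [LinearOrder ι] :
    (Finset ι →₀ ℚ) →ₗ[ℚ] (Finset ι →₀ ℚ) :=
  Finsupp.linearCombination ℚ fun σ : Finset ι =>
    ∑ v ∈ σ, Finsupp.single (σ.erase v) ((-1 : ℚ) ^ (σ.filter (· < v)).card)

/-- The cycles of dimension `n - 1` of the augmented chain complex. -/
noncomputable def augCycles [LinearOrder ι] (K : PreAbstractSimplicialComplex ι) (n : ℕ) :
    Submodule ℚ (Finset ι →₀ ℚ) :=
  K.augChains n ⊓ LinearMap.ker (augBoundary ι)

/-- The boundaries of dimension `n - 1` of the augmented chain complex. -/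
noncomputable def augBoundaries [LinearOrder ι] (K : PreAbstractSimplicialComplex ι) (n : ℕ) :
    Submodule ℚ (Finset ι →₀ ℚ) :=
  (K.augChains (n + 1)).map (augBoundary ι)

/-- `K.ReducedHomology n` is the reduced rational homology group of `K` in degree `n - 1`:
cycles modulo boundaries in the augmented chain complex. -/
abbrev ReducedHomology [LinearOrder ι] (K : PreAbstractSimplicialComplex ι) (n : ℕ) : Type _ :=
  K.augCycles n ⧸ (K.augBoundaries n).submoduleOf (K.augCycles n)

/-- The total reduced Betti number of a simplicial complex on finitely many vertices: the sum of
`dim H̃ᵢ(K; ℚ)` over `i = n - 1` with `0 ≤ n ≤ |ι|`. There are no faces with more than `|ι|`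
vertices, hence no homology in the other degrees. -/
noncomputable def totalBetti [LinearOrder ι] [Finite ι]
    (K : PreAbstractSimplicialComplex ι) : ℕ :=
  ∑ n ∈ Finset.range (Nat.card ι + 1), Module.finrank ℚ (K.ReducedHomology n)

end PreAbstractSimplicialComplex

/-! ### Independence complexes -/

/-- The independence complex of a graph: its vertices are the vertices of `G` and its (nonempty)
faces are the (nonempty) finite independent sets of `G`. -/
def SimpleGraph.independenceComplex {V : Type*} (G : SimpleGraph V) :
    AbstractSimplicialComplex V where
  faces := {σ | σ.Nonempty ∧ G.IsIndepSet (σ : Set V)}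
  isRelLowerSet_faces := fun _ hσ =>
    ⟨hσ.1, fun _ hτ hne => ⟨hne, hσ.2.mono (Finset.coe_subset.2 hτ)⟩⟩
  singleton_mem v := ⟨Finset.singleton_nonempty v, by simp [SimpleGraph.IsIndepSet]⟩

/-! ### The hexagonal dimer (Kagome) lattice

The pair `(a, b)` stands for the point `a • (1, 0) + b • (1/2, √3/2)` of the plane, so that `ℤ × ℤ`
is the vertex set of the triangular lattice with edges of length `1`. -/

/-- The distance from the origin in the triangular lattice. The points with `hexNorm p ≤ r` are the
lattice points in a regular hexagon of side `r` centred at the origin. -/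
def hexNorm (p : ℤ × ℤ) : ℤ := max (max |p.1| |p.2|) |p.1 + p.2|

/-- The triangular lattice: points at distance `1` are adjacent. -/
def triangularLattice : SimpleGraph (ℤ × ℤ) where
  Adj p q := hexNorm (q - p) = 1
  symm := ⟨fun p q h => by
    have : hexNorm (p - q) = hexNorm (q - p) := by
      simp only [hexNorm, Prod.fst_sub, Prod.snd_sub]
      rw [abs_sub_comm p.1, abs_sub_comm p.2, ← abs_neg (p.1 - q.1 + (p.2 - q.2))]
      congr 2
      ring
    exact this.trans h⟩
  loopless := ⟨fun p h => by simp [hexNorm] at h⟩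

/-- The lattice lines of the triangular lattice are `a = c`, `b = c` and `a + b = c` for `c : ℤ`.
Every other line in each direction is erased, namely those with `c` even. The vertices that remain
are the points on at least one remaining line. -/
def KagomeVertex : Type :=
  {p : ℤ × ℤ // Odd p.1 ∨ Odd p.2 ∨ Odd (p.1 + p.2)}

/-- The hexagonal dimer, or Kagome, lattice: the edges are those edges of the triangular lattice
that lie on a line that was not erased. -/
def kagomeLattice : SimpleGraph KagomeVertex where
  Adj p q := triangularLattice.Adj p.1 q.1 ∧
    ((p.1.1 = q.1.1 ∧ Odd p.1.1) ∨ (p.1.2 = q.1.2 ∧ Odd p.1.2) ∨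
      (p.1.1 + p.1.2 = q.1.1 + q.1.2 ∧ Odd (p.1.1 + p.1.2)))
  symm := ⟨fun p q h => by
    refine ⟨h.1.symm, ?_⟩
    rcases h.2 with ⟨h1, h2⟩ | ⟨h1, h2⟩ | ⟨h1, h2⟩
    · exact Or.inl ⟨h1.symm, h1 ▸ h2⟩
    · exact Or.inr (Or.inl ⟨h1.symm, h1 ▸ h2⟩)
    · exact Or.inr (Or.inr ⟨h1.symm, h1 ▸ h2⟩)⟩
  loopless := ⟨fun p h => triangularLattice.irrefl h.1⟩

/-- The points `(2i, 2j)`. As vectors, these are the translations that preserve the Kagome lattice;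
as points, they are the centres of its small hexagons. -/
def kagomeTranslations : AddSubgroup (ℤ × ℤ) :=
  AddSubgroup.closure {(2, 0), (0, 2)}

/-! ### Finite quotients of the lattice -/

/-- Two vertices of the Kagome lattice are identified if they differ by a translation in `Λ`. -/
def translationSetoid (Λ : AddSubgroup (ℤ × ℤ)) : Setoid KagomeVertex where
  r p q := q.1 - p.1 ∈ Λ
  iseqv :=
    { refl := fun p => by simp
      symm := fun {p q} h => by simpa using Λ.neg_mem h
      trans := fun {p q r} h₁ h₂ => by simpa using Λ.add_mem h₂ h₁ }

/-- The vertices of the quotient of the Kagome lattice by the translations in `Λ`. -/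
abbrev HexDimerVertex (Λ : AddSubgroup (ℤ × ℤ)) : Type := Quotient (translationSetoid Λ)

/-- The quotient of the Kagome lattice by the translations in `Λ`: two distinct classes are adjacent
if they have adjacent representatives. -/
def hexDimer (Λ : AddSubgroup (ℤ × ℤ)) : SimpleGraph (HexDimerVertex Λ) where
  Adj x y := x ≠ y ∧ ∃ p q : KagomeVertex,
    Quotient.mk (translationSetoid Λ) p = x ∧ Quotient.mk (translationSetoid Λ) q = y ∧
      kagomeLattice.Adj p q
  symm := ⟨fun _ _ h => by
    obtain ⟨hne, p, q, hp, hq, hpq⟩ := h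
    exact ⟨hne.symm, q, p, hq, hp, hpq.symm⟩⟩
  loopless := ⟨fun _ h => h.1 rfl⟩

/-! ### The tiling by large hexagons -/

/-- The large hexagon centred at `c`: the vertices of the Kagome lattice in the regular hexagon of
side `3` with centre `c`. For a centre `c` of a small hexagon these are the `30` vertices of the
seven small hexagons consisting of the one centred at `c` and the six nearest to it. -/
def largeHexagon (c : ℤ × ℤ) : Set KagomeVertex := {p | hexNorm (p.1 - c) ≤ 3}

/-- The lattice spanned by the vectors `(6, 2√3)` and `(0, 4√3)` of the plane, which are written
`(4, 4)` and `(-4, 8)` in the coordinates used here. -/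
def tilingLattice : AddSubgroup (ℤ × ℤ) :=
  AddSubgroup.closure {(4, 4), (-4, 8)}

/-- The tiling of the Kagome lattice by large hexagons, one of which is centred at `c`: the set of
large hexagons with centres in `c + tilingLattice`. Neighbouring tiles are disjoint, not joined by
edges, and separated by rows of vertices that belong to no tile. -/
def hexTiling (c : ℤ × ℤ) : Set (Set KagomeVertex) :=
  {T | ∃ s ∈ tilingLattice, T = largeHexagon (c + s)}

/-- The translate `l + T` of a set of vertices of the Kagome lattice. -/
def translateTile (l : ℤ × ℤ) (T : Set KagomeVertex) : Set KagomeVertex :=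
  {p | ∃ q ∈ T, p.1 = l + q.1}

/-- The quotient of the Kagome lattice by `Λ` can be tiled with large hexagons: some tiling of the
Kagome lattice by large hexagons, centred at centres of small hexagons, is preserved by all the
translations in `Λ`, and so descends to the quotient. -/
def Tileable (Λ : AddSubgroup (ℤ × ℤ)) : Prop :=
  ∃ c ∈ kagomeTranslations, ∀ l ∈ Λ, ∀ T ∈ hexTiling c, translateTile l T ∈ hexTiling c

/-!
The homology of the independence complex is estimated by deleting vertices. For a vertex `v` of a
graph the total Betti number satisfies `β(G) ≤ β(G - v) + β(G - N[v])`, because `I(G - v)` and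
`I(G - N[v])` are the deletion and the link of `v` in `I(G)`; it vanishes if `v` is isolated,
because `I(G)` is then a cone; and it is `1` for the graph without vertices. Over `ℚ` these facts
follow from linear algebra: the total Betti number is the number of faces, the empty one included,
minus twice the rank of the boundary operator (`totalBetti_eq_faceBetti`), and the boundary matrix
is block triangular with respect to the faces without `v` and those with `v`
(`boundaryRank_deletion_add_link_le`).

A tiling by large hexagons has cells of 36 vertices: the 30 vertices of a tile, and 6 vertices in
the gaps between the tiles. Applying the inequality to all gap vertices, of which a quotient with
`n` tiles has at most `6 n`, gives at most `2 ^ (6 n)` graphs (`indepBetti_le_two_pow_mul`). Each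
of them is a disjoint union of `n` large hexagons from which the neighbours of some of the 12
surrounding gap vertices have been removed (`IsTransversal.withoutNbrs_eq_biUnion`). For each of
the `2 ^ 12` damaged hexagons the inequality, applied repeatedly, leads to graphs with an isolated
vertex and to at most 14 graphs without vertices; this is a finite computation
(`allBoundedBy_tileMask`). Carrying it out in one tile of a disjoint union, while the other tiles
are left alone, shows that each tile contributes a factor of at most 14
(`IsTransversal.indepBetti_biUnion_le`), so that no Künneth formula is needed. Hence the total
Betti number is at most `(14 * 2 ^ 6) ^ n`, and the quotient has at least `36 n` vertices
(`IsTransversal.card_mul_le`).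

The quotient may identify tiles, but nonzero translations of the tiling have length at least `8`,
so each tile is embedded as an induced subgraph and different tiles are not adjacent
(`IsTransversal.adj_tileMap_iff`).
-/

namespace HexDimer

/-! ### Boundary operators and their ranks -/

section Chains

variable {V : Type*} [LinearOrder V]

/-- The sign `(-1) ^ #{w ∈ σ | w < v}`. -/
def faceSign (σ : Finset V) (v : V) : ℚ := (-1 : ℚ) ^ (σ.filter (· < v)).card

/-- Contraction of chains by the vertex `v`: the part of the boundary in which `v` is omitted. -/
noncomputable def contract (v : V) : (Finset V →₀ ℚ) →ₗ[ℚ] (Finset V →₀ ℚ) :=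
  Finsupp.linearCombination ℚ fun σ : Finset V =>
    if v ∈ σ then Finsupp.single (σ.erase v) (faceSign σ v) else 0

theorem contract_single (v : V) (σ : Finset V) (c : ℚ) :
    contract v (Finsupp.single σ c) =
      if v ∈ σ then Finsupp.single (σ.erase v) (c * faceSign σ v) else 0 := by
  simp only [contract, Finsupp.linearCombination_single]
  split_ifs <;> simp

theorem faceSign_erase_of_lt {σ : Finset V} {v w : V} (hv : v ∈ σ) (h : v < w) :
    faceSign (σ.erase v) w = -faceSign σ w := by
  have hm : v ∈ σ.filter (· < w) := by simp [hv, h]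
  unfold faceSign
  rw [Finset.filter_erase, ← Finset.card_erase_add_one hm, pow_succ]
  ring

theorem faceSign_erase_of_le {σ : Finset V} {v w : V} (h : w ≤ v) :
    faceSign (σ.erase v) w = faceSign σ w := by
  unfold faceSign
  rw [Finset.filter_erase, Finset.erase_eq_of_notMem (by simp [h])]

theorem faceSign_mul_anticomm {σ : Finset V} {v w : V} (hv : v ∈ σ) (hw : w ∈ σ) (h : v ≠ w) :
    faceSign σ w * faceSign (σ.erase w) v = -(faceSign σ v * faceSign (σ.erase v) w) := by
  rcases lt_or_gt_of_ne h with h | h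
  · rw [faceSign_erase_of_lt hv h, faceSign_erase_of_le h.le]; ring
  · rw [faceSign_erase_of_lt hw h, faceSign_erase_of_le h.le]; ring

/-- Contractions by vertices anticommute. -/
theorem contract_contract (v w : V) (x : Finset V →₀ ℚ) :
    contract v (contract w x) = -contract w (contract v x) := by
  induction x using Finsupp.induction_linear with
  | zero => simp
  | add x y hx hy => simp only [map_add, hx, hy, neg_add]
  | single σ c =>
    by_cases hvw : v = w
    · subst hvw
      by_cases hv : v ∈ σ <;> simp [contract_single, hv, -Finsupp.single_mul]
    · by_cases hv : v ∈ σ <;> by_cases hw : w ∈ σ <;>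
        simp [contract_single, hv, hw, hvw, Ne.symm hvw, -Finsupp.single_mul]
      rw [Finset.erase_right_comm, ← Finsupp.single_neg, mul_assoc, mul_assoc,
        faceSign_mul_anticomm hv hw hvw, mul_neg]

theorem augBoundary_eq_sum [Fintype V] (x : Finset V →₀ ℚ) :
    PreAbstractSimplicialComplex.augBoundary V x = ∑ v, contract v x := by
  induction x using Finsupp.induction_linear with
  | zero => simp
  | add x y hx hy => simp only [map_add, hx, hy, Finset.sum_add_distrib]
  | single σ c =>
    simp only [contract_single, PreAbstractSimplicialComplex.augBoundary,
      Finsupp.linearCombination_single, Finset.sum_ite_mem, Finset.univ_inter, Finset.smul_sum,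
      Finsupp.smul_single, smul_eq_mul, faceSign]

theorem contract_augBoundary [Fintype V] (v : V) (x : Finset V →₀ ℚ) :
    contract v (PreAbstractSimplicialComplex.augBoundary V x) =
      -PreAbstractSimplicialComplex.augBoundary V (contract v x) := by
  simp only [augBoundary_eq_sum, map_sum, contract_contract v, Finset.sum_neg_distrib]

theorem augBoundary_augBoundary [Fintype V] (x : Finset V →₀ ℚ) :
    PreAbstractSimplicialComplex.augBoundary V
      (PreAbstractSimplicialComplex.augBoundary V x) = 0 := by
  -- The boundary operator anticommutes with every contraction, hence with itself.
  have h : PreAbstractSimplicialComplex.augBoundary V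
      (PreAbstractSimplicialComplex.augBoundary V x) =
      -PreAbstractSimplicialComplex.augBoundary V
        (PreAbstractSimplicialComplex.augBoundary V x) := by
    conv_lhs => rw [augBoundary_eq_sum]
    simp only [contract_augBoundary, Finset.sum_neg_distrib, ← map_sum, ← augBoundary_eq_sum]
  exact self_eq_neg.1 h

end Chains

section Rank

theorem finrank_supported {α : Type*} (A : Finset α) :
    Module.finrank ℚ (Finsupp.supported ℚ ℚ (A : Set α)) = A.card := by
  rw [(Finsupp.supportedEquivFinsupp _).finrank_eq, Module.finrank_finsupp_self]
  simp

theorem filter_card_eq_empty {α : Type*} [Fintype α] (F : Finset (Finset α)) {n : ℕ}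
    (hn : Fintype.card α < n) :
    F.filter (·.card = n) = ∅ :=
  Finset.filter_eq_empty_iff.2 fun σ _ h => (h ▸ σ.card_le_univ).not_gt hn

variable {V : Type*} [LinearOrder V]

open PreAbstractSimplicialComplex

/-- The rank of the boundary operator on the chains spanned by the faces in `A`. -/
noncomputable def boundaryRank (A : Finset (Finset V)) : ℕ :=
  Module.finrank ℚ ((Finsupp.supported ℚ ℚ (A : Set (Finset V))).map (augBoundary V))

/-- The members of `A` that do not contain `v`. -/
def deletion (A : Finset (Finset V)) (v : V) : Finset (Finset V) := A.filter (v ∉ ·)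

/-- The sets without `v` whose union with `v` belongs to `A`. -/
def link (A : Finset (Finset V)) (v : V) : Finset (Finset V) :=
  (A.filter (v ∈ ·)).image (·.erase v)

theorem mem_link {A : Finset (Finset V)} {v : V} {σ : Finset V} :
    σ ∈ link A v ↔ v ∉ σ ∧ insert v σ ∈ A := by
  simp only [link, Finset.mem_image, Finset.mem_filter]
  constructor
  · rintro ⟨τ, ⟨hτ, hv⟩, rfl⟩
    simp [Finset.insert_erase hv, hτ]
  · rintro ⟨hv, h⟩
    exact ⟨insert v σ, ⟨h, by simp⟩, Finset.erase_insert hv⟩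

theorem card_deletion_add_card_link (A : Finset (Finset V)) (v : V) :
    (deletion A v).card + (link A v).card = A.card := by
  rw [link, Finset.card_image_of_injOn, deletion, add_comm,
    Finset.card_filter_add_card_filter_not]
  intro σ hσ τ hτ h
  simp only [Finset.coe_filter, Set.mem_ofPred_eq] at hσ hτ
  rw [← Finset.insert_erase hσ.2, ← Finset.insert_erase hτ.2]
  exact congrArg (insert v) h

theorem deletion_filter_card (F : Finset (Finset V)) (v : V) (n : ℕ) :
    deletion (F.filter (·.card = n)) v = (deletion F v).filter (·.card = n) := by
  simp only [deletion, Finset.filter_filter, and_comm]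

theorem link_filter_card_succ (F : Finset (Finset V)) (v : V) (n : ℕ) :
    link (F.filter (·.card = n + 1)) v = (link F v).filter (·.card = n) := by
  ext σ
  simp only [mem_link, Finset.mem_filter]
  constructor
  · rintro ⟨hv, h, hc⟩
    rw [Finset.card_insert_of_notMem hv] at hc
    exact ⟨⟨hv, h⟩, by omega⟩
  · rintro ⟨⟨hv, h⟩, hc⟩
    exact ⟨hv, h, by rw [Finset.card_insert_of_notMem hv, hc]⟩

theorem map_contract_supported (A : Finset (Finset V)) (v : V) :
    (Finsupp.supported ℚ ℚ (A : Set (Finset V))).map (contract v) =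
      Finsupp.supported ℚ ℚ (link A v : Set (Finset V)) := by
  apply le_antisymm
  · rw [Finsupp.supported_eq_span_single, Submodule.map_span, Submodule.span_le]
    rintro _ ⟨_, ⟨σ, hσ, rfl⟩, rfl⟩
    simp only [contract_single]
    split_ifs with hv
    · exact Finsupp.single_mem_supported ℚ _ (by
        simpa [mem_link, Finset.insert_erase hv] using hσ)
    · exact Submodule.zero_mem _
  · conv_lhs => rw [Finsupp.supported_eq_span_single]
    rw [Submodule.span_le]
    rintro _ ⟨σ, hσ, rfl⟩
    obtain ⟨hv, h⟩ := mem_link.1 (Finset.mem_coe.1 hσ)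
    refine ⟨Finsupp.single (insert v σ) (faceSign (insert v σ) v),
      Finsupp.single_mem_supported ℚ _ h, ?_⟩
    rw [contract_single, if_pos (Finset.mem_insert_self v σ), Finset.erase_insert hv, faceSign,
      ← pow_add, Even.neg_one_pow ⟨_, rfl⟩]

theorem contract_eq_zero {A : Finset (Finset V)} {v : V} {x : Finset V →₀ ℚ}
    (hx : x ∈ Finsupp.supported ℚ ℚ (deletion A v : Set (Finset V))) : contract v x = 0 := by
  have h : Finsupp.supported ℚ ℚ (deletion A v : Set (Finset V)) ≤ LinearMap.ker (contract v) := by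
    rw [Finsupp.supported_eq_span_single, Submodule.span_le]
    rintro _ ⟨σ, hσ, rfl⟩
    have : v ∉ σ := (Finset.mem_filter.1 (Finset.mem_coe.1 hσ)).2
    simp [contract_single, this]
  exact h hx

/-- Rank–nullity for a linear map restricted to a subspace. -/
theorem finrank_map_add_finrank_inf_ker {M N : Type*} [AddCommGroup M] [Module ℚ M]
    [AddCommGroup N] [Module ℚ N] [Module.Finite ℚ M] (f : M →ₗ[ℚ] N) (p : Submodule ℚ M) :
    Module.finrank ℚ (p.map f) + Module.finrank ℚ ↥(p ⊓ LinearMap.ker f) =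
      Module.finrank ℚ p := by
  have h := LinearMap.finrank_range_add_finrank_ker (f.domRestrict p)
  rw [LinearMap.range_domRestrict] at h
  rw [← h, LinearMap.ker_domRestrict, ← Submodule.map_comap_subtype,
    Submodule.finrank_map_subtype_eq]

variable [Fintype V]

/-- The boundary matrix is block triangular with respect to the splitting of the faces into those
without `v` and those with `v`, and its diagonal blocks are the boundary matrices of the deletion
and of the link. -/
theorem boundaryRank_deletion_add_link_le (A : Finset (Finset V)) (v : V) :
    boundaryRank (deletion A v) + boundaryRank (link A v) ≤ boundaryRank A := by
  unfold boundaryRank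
  rw [← finrank_map_add_finrank_inf_ker (contract v)
    ((Finsupp.supported ℚ ℚ (A : Set (Finset V))).map (augBoundary V)), add_comm]
  refine add_le_add (le_of_eq ?_) (Submodule.finrank_mono ?_)
  · rw [← map_contract_supported]
    have e : ∀ p : Submodule ℚ (Finset V →₀ ℚ), (p.map (contract v)).map (augBoundary V) =
        (p.map (augBoundary V)).map (contract v) := by
      intro p
      ext y
      simp only [Submodule.mem_map, exists_exists_and_eq_and, contract_augBoundary]
      constructor <;>
      · rintro ⟨x, hx, rfl⟩
        exact ⟨-x, Submodule.neg_mem _ hx, by simp⟩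
    rw [e]
  · rintro _ ⟨x, hx, rfl⟩
    refine ⟨⟨x, Finsupp.supported_mono (by
      exact_mod_cast Finset.filter_subset _ A) hx, rfl⟩, ?_⟩
    rw [SetLike.mem_coe, LinearMap.mem_ker, contract_augBoundary, contract_eq_zero hx, map_zero,
      neg_zero]

/-- The boundaries of the sets `σ ∪ {v}`, for `σ` in the link, are linearly independent: the part
of such a boundary without `v` is `± σ`. -/
theorem card_link_le_boundaryRank (A : Finset (Finset V)) (v : V) :
    (link A v).card ≤ boundaryRank A := by
  let R : (Finset V →₀ ℚ) →ₗ[ℚ] (Finset V →₀ ℚ) :=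
    Finsupp.linearCombination ℚ fun σ : Finset V => if v ∈ σ then 0 else Finsupp.single σ 1
  have hR : ∀ (σ : Finset V) (c : ℚ), R (Finsupp.single σ c) =
      if v ∈ σ then 0 else Finsupp.single σ c := by
    intro σ c
    simp only [R, Finsupp.linearCombination_single]
    split_ifs <;> simp
  have hle : Finsupp.supported ℚ ℚ (link A v : Set (Finset V)) ≤
      ((Finsupp.supported ℚ ℚ (A : Set (Finset V))).map (augBoundary V)).map R := by
    rw [Finsupp.supported_eq_span_single, Submodule.span_le]
    rintro _ ⟨σ, hσ, rfl⟩
    obtain ⟨hv, h⟩ := mem_link.1 (Finset.mem_coe.1 hσ)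
    refine ⟨_, ⟨Finsupp.single (insert v σ) (faceSign (insert v σ) v),
      Finsupp.single_mem_supported ℚ _ h, rfl⟩, ?_⟩
    rw [augBoundary_eq_sum, map_sum, Finset.sum_eq_single v]
    · rw [contract_single, if_pos (Finset.mem_insert_self v σ), Finset.erase_insert hv, hR,
        if_neg hv, faceSign, ← pow_add, Even.neg_one_pow ⟨_, rfl⟩]
    · intro w _ hw
      rw [contract_single]
      split_ifs
      · rw [hR, if_pos (by simp [hw.symm])]
      · exact map_zero R
    · simp
  calc (link A v).card
      = Module.finrank ℚ (Finsupp.supported ℚ ℚ (link A v : Set (Finset V))) :=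
        (finrank_supported _).symm
    _ ≤ _ := Submodule.finrank_mono hle
    _ ≤ boundaryRank A := Submodule.finrank_map_le _ _

end Rank

section FaceBetti

variable {V : Type*} [LinearOrder V] [Fintype V]

open PreAbstractSimplicialComplex

/-- The rank of the boundary operator of the complex with the set of faces `F`, summed over all
degrees. -/
noncomputable def totalRank (F : Finset (Finset V)) : ℕ :=
  ∑ n ∈ Finset.range (Fintype.card V + 2), boundaryRank (F.filter (·.card = n))

/-- The sum of the reduced Betti numbers of the simplicial complex with the set of faces `F`
(the empty face included): the number of faces minus twice the rank of the boundary operator. -/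
noncomputable def faceBetti (F : Finset (Finset V)) : ℤ :=
  F.card - 2 * totalRank F

theorem boundaryRank_empty : boundaryRank (∅ : Finset (Finset V)) = 0 := by
  simp [boundaryRank, Finsupp.supported_empty]

/-- The total Betti number of a complex is at most that of the deletion of a vertex plus that of
its link. -/
theorem faceBetti_le_deletion_add_link (F : Finset (Finset V)) (v : V) :
    faceBetti F ≤ faceBetti (deletion F v) + faceBetti (link F v) := by
  have hcard := card_deletion_add_card_link F v
  have hrank : totalRank (deletion F v) + totalRank (link F v) ≤ totalRank F := by
    unfold totalRank
    rw [Finset.sum_range_succ (fun n => boundaryRank ((link F v).filter (·.card = n))),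
      filter_card_eq_empty _ (Nat.lt_succ_self _), boundaryRank_empty, add_zero,
      Finset.sum_range_succ', Finset.sum_range_succ' (fun n => boundaryRank (F.filter _)),
      add_right_comm, ← Finset.sum_add_distrib]
    refine add_le_add (Finset.sum_le_sum fun n _ => ?_) ?_
    · rw [← deletion_filter_card, ← link_filter_card_succ]
      exact boundaryRank_deletion_add_link_le _ v
    · rw [← deletion_filter_card]
      exact (Nat.le_add_right _ _).trans (boundaryRank_deletion_add_link_le _ v)
  unfold faceBetti
  omega

/-- A cone has no reduced homology: half of its faces contain the apex `v`, and their boundaries are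
linearly independent. -/
theorem faceBetti_le_zero_of_link_eq {F : Finset (Finset V)} {v : V}
    (h : link F v = deletion F v) : faceBetti F ≤ 0 := by
  have hcard := card_deletion_add_card_link F v
  rw [← h] at hcard
  have hrank : (link F v).card ≤ totalRank F := by
    rw [totalRank, Finset.sum_range_succ', Finset.card_eq_sum_card_fiberwise (f := Finset.card)
      (t := Finset.range (Fintype.card V + 1))
      (fun σ _ => by simpa [Nat.lt_succ_iff] using σ.card_le_univ)]
    refine le_add_right (Finset.sum_le_sum fun n _ => ?_)
    rw [← link_filter_card_succ]
    exact card_link_le_boundaryRank _ v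
  unfold faceBetti
  omega

theorem faceBetti_singleton_empty_le : faceBetti ({∅} : Finset (Finset V)) ≤ 1 := by
  unfold faceBetti
  rw [Finset.card_singleton]
  omega

/-- Rank–nullity for the boundary operators into and out of one degree. -/
theorem boundaryRank_add_finrank_reducedHomology (K : PreAbstractSimplicialComplex V)
    {F : Finset (Finset V)} (hF : ∀ σ, σ ∈ F ↔ σ = ∅ ∨ σ ∈ K) (n : ℕ) :
    boundaryRank (F.filter (·.card = n)) + boundaryRank (F.filter (·.card = n + 1)) +
      Module.finrank ℚ (K.ReducedHomology n) = (F.filter (·.card = n)).card := by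
  have hchains : ∀ n, K.augChains n =
      Finsupp.supported ℚ ℚ ((F.filter (·.card = n) : Finset (Finset V)) : Set (Finset V)) := by
    intro n
    unfold augChains
    congr 1
    ext σ
    simp [augFaces, hF, and_comm]
  have hB : K.augBoundaries n ≤ K.augCycles n := by
    have hsub : K.augChains (n + 1) ≤ (K.augCycles n).comap (augBoundary V) := by
      conv_lhs => rw [augChains, Finsupp.supported_eq_span_single]
      rw [Submodule.span_le]
      rintro _ ⟨σ, ⟨hc, hσ⟩, rfl⟩
      refine ⟨?_, by
        rw [SetLike.mem_coe, LinearMap.mem_ker]; exact augBoundary_augBoundary _⟩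
      rw [augBoundary_eq_sum]
      refine Submodule.sum_mem _ fun v _ => ?_
      rw [contract_single]
      split_ifs with hv
      · refine Finsupp.single_mem_supported ℚ _ ⟨by rw [Finset.card_erase_of_mem hv, hc]; rfl, ?_⟩
        by_cases he : σ.erase v = ∅
        · exact Or.inl he
        · rcases hσ with rfl | hσ
          · simp at hv
          · exact Or.inr ((K.isRelLowerSet_faces hσ).2 (Finset.erase_subset _ _)
              (Finset.nonempty_iff_ne_empty.2 he))
      · exact Submodule.zero_mem _
    rintro _ ⟨x, hx, rfl⟩
    exact hsub hx
  have h1 := Submodule.finrank_quotient_add_finrank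
    ((K.augBoundaries n).submoduleOf (K.augCycles n))
  rw [(Submodule.submoduleOfEquivOfLe hB).finrank_eq] at h1
  have h2 := finrank_map_add_finrank_inf_ker (augBoundary V) (K.augChains n)
  rw [hchains n, finrank_supported] at h2
  have h3 : Module.finrank ℚ (K.augBoundaries n) = boundaryRank (F.filter (·.card = n + 1)) := by
    rw [augBoundaries, hchains]; rfl
  have h4 : Module.finrank ℚ (K.augCycles n) = Module.finrank ℚ
      ↥(Finsupp.supported ℚ ℚ ((F.filter (·.card = n) : Finset (Finset V)) : Set (Finset V)) ⊓
        LinearMap.ker (augBoundary V)) := by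
    rw [augCycles, hchains]
  rw [← h2, ← h4, ← h1, h3, boundaryRank]
  ring

/-- The Euler–Poincaré count: the total Betti number is the number of faces minus twice the rank
of the boundary operator. -/
theorem totalBetti_eq_faceBetti (K : PreAbstractSimplicialComplex V) {F : Finset (Finset V)}
    (hF : ∀ σ, σ ∈ F ↔ σ = ∅ ∨ σ ∈ K) : (K.totalBetti : ℤ) = faceBetti F := by
  have hcard : F.card = ∑ n ∈ Finset.range (Fintype.card V + 1), (F.filter (·.card = n)).card :=
    Finset.card_eq_sum_card_fiberwise
      (fun σ _ => by simpa [Nat.lt_succ_iff] using σ.card_le_univ)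
  have hzero : boundaryRank (F.filter (·.card = 0)) = 0 := by
    have : F.filter (·.card = 0) = {∅} := by
      ext σ
      simp only [Finset.mem_filter, Finset.card_eq_zero, Finset.mem_singleton, hF]
      tauto
    rw [boundaryRank, this, Finset.coe_singleton, Finsupp.supported_eq_span_single]
    have h0 : augBoundary V (Finsupp.single ∅ 1) = 0 := by
      simp [augBoundary, Finsupp.linearCombination_single]
    rw [Submodule.map_span, Set.image_singleton, Set.image_singleton, h0,
      Submodule.span_zero_singleton, finrank_bot]
  have hsum := Finset.sum_congr rfl fun n (_ : n ∈ Finset.range (Fintype.card V + 1)) =>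
    boundaryRank_add_finrank_reducedHomology K hF n
  rw [Finset.sum_add_distrib, Finset.sum_add_distrib, ← hcard] at hsum
  have hlast : totalRank F =
      ∑ n ∈ Finset.range (Fintype.card V + 1), boundaryRank (F.filter (·.card = n)) := by
    rw [totalRank, Finset.sum_range_succ, filter_card_eq_empty _ (Nat.lt_succ_self _),
      boundaryRank_empty, add_zero]
  have hfirst : totalRank F =
      ∑ n ∈ Finset.range (Fintype.card V + 1), boundaryRank (F.filter (·.card = n + 1)) := by
    rw [totalRank, Finset.sum_range_succ', hzero, add_zero]
  unfold faceBetti totalBetti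
  rw [Nat.card_eq_fintype_card]
  omega

end FaceBetti

/-! ### Independence complexes of induced subgraphs -/

section GraphBetti

variable {V : Type*} [LinearOrder V] (G : SimpleGraph V) [DecidableRel G.Adj]

open Classical in
/-- The independent sets of `G` that are contained in `W`. -/
noncomputable def indepSets (W : Finset V) : Finset (Finset V) :=
  W.powerset.filter fun σ => G.IsIndepSet (σ : Set V)

theorem mem_indepSets {W σ : Finset V} :
    σ ∈ indepSets G W ↔ σ ⊆ W ∧ G.IsIndepSet (σ : Set V) := by
  simp [indepSets]

/-- The vertices of `W` that have no neighbour in `E`. -/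
def withoutNbrs (W E : Finset V) : Finset V := W.filter fun x => ∀ d ∈ E, ¬ G.Adj d x

theorem mem_withoutNbrs {V : Type*} (G : SimpleGraph V) [DecidableRel G.Adj] {W E : Finset V}
    {x : V} :
    x ∈ withoutNbrs G W E ↔ x ∈ W ∧ ∀ d ∈ E, ¬ G.Adj d x := by
  simp [withoutNbrs]

theorem deletion_indepSets (W : Finset V) (v : V) :
    deletion (indepSets G W) v = indepSets G (W.erase v) := by
  ext σ
  simp only [deletion, Finset.mem_filter, mem_indepSets, Finset.subset_erase]
  tauto

theorem link_indepSets {W : Finset V} {v : V} (hv : v ∈ W) :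
    link (indepSets G W) v = indepSets G (withoutNbrs G (W.erase v) {v}) := by
  have : Std.Symm fun x y => ¬ G.Adj x y := ⟨fun _ _ h h' => h h'.symm⟩
  ext σ
  simp only [mem_link, mem_indepSets, Finset.insert_subset_iff, hv, true_and, Finset.coe_insert,
    SimpleGraph.IsIndepSet, Set.pairwise_insert_of_symm]
  constructor
  · rintro ⟨hvσ, hσ, hi, ha⟩
    refine ⟨fun x hx => ?_, hi⟩
    have hxv : x ≠ v := fun h => hvσ (h ▸ hx)
    simp only [mem_withoutNbrs, Finset.mem_erase, Finset.mem_singleton, forall_eq]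
    exact ⟨⟨hxv, hσ hx⟩, ha x hx hxv.symm⟩
  · rintro ⟨hσ, hi⟩
    have h : ∀ x ∈ σ, (x ≠ v ∧ x ∈ W) ∧ ¬ G.Adj v x := fun x hx => by
      simpa [withoutNbrs] using hσ hx
    exact ⟨fun hvσ => (h v hvσ).1.1 rfl, fun x hx => (h x hx).1.2, hi,
      fun x hx _ => (h x hx).2⟩

variable [Fintype V]

/-- The total reduced Betti number of the independence complex of the subgraph of `G` induced
on `W`. -/
noncomputable def indepBetti (W : Finset V) : ℤ := faceBetti (indepSets G W)

theorem indepBetti_le_erase_add {W : Finset V} {v : V} (hv : v ∈ W) :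
    indepBetti G W ≤
      indepBetti G (W.erase v) + indepBetti G (withoutNbrs G (W.erase v) {v}) := by
  have h := faceBetti_le_deletion_add_link (indepSets G W) v
  rwa [deletion_indepSets, link_indepSets G hv] at h

/-- An isolated vertex is the apex of a cone. -/
theorem indepBetti_le_zero {W : Finset V} {v : V} (hv : v ∈ W) (h : ∀ x ∈ W, ¬ G.Adj v x) :
    indepBetti G W ≤ 0 := by
  refine faceBetti_le_zero_of_link_eq (v := v) ?_
  have hW : withoutNbrs G (W.erase v) {v} = W.erase v := by
    ext x
    simp only [mem_withoutNbrs, Finset.mem_singleton, forall_eq, and_iff_left_iff_imp]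
    exact fun hx => h x (Finset.mem_of_mem_erase hx)
  rw [deletion_indepSets, link_indepSets G hv, hW]

theorem indepBetti_empty_le : indepBetti G ∅ ≤ 1 := by
  have : indepSets G (∅ : Finset V) = {∅} := by
    ext σ
    simp only [mem_indepSets, Finset.subset_empty, Finset.mem_singleton, and_iff_left_iff_imp]
    rintro rfl
    simp [SimpleGraph.IsIndepSet]
  rw [indepBetti, this]
  exact faceBetti_singleton_empty_le

theorem totalBetti_independenceComplex :
    (G.independenceComplex.totalBetti : ℤ) = indepBetti G Finset.univ := by
  refine totalBetti_eq_faceBetti _ fun σ => ?_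
  rw [mem_indepSets]
  change _ ↔ σ = ∅ ∨ σ.Nonempty ∧ G.IsIndepSet (σ : Set V)
  rcases σ.eq_empty_or_nonempty with rfl | h
  · simp [SimpleGraph.IsIndepSet]
  · simp [h, h.ne_empty]

/-- Removing the vertices of `D` one at a time, each of which is either deleted or selected, bounds
the total Betti number by the sum over the `2 ^ #D` possible selections. -/
theorem indepBetti_le_two_pow_mul (D : Finset V) {B : ℤ} (hB : 0 ≤ B) (W : Finset V)
    (h : ∀ E ⊆ D, indepBetti G (withoutNbrs G (W \ D) E) ≤ B) :
    indepBetti G W ≤ 2 ^ D.card * B := by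
  induction D using Finset.induction_on generalizing W with
  | empty => simpa [withoutNbrs] using h ∅ subset_rfl
  | insert v D hv ih =>
    have h1 : indepBetti G (W.erase v) ≤ 2 ^ D.card * B := by
      refine ih _ fun E hE => ?_
      have := h E (hE.trans (Finset.subset_insert _ _))
      rwa [Finset.sdiff_insert, ← Finset.erase_sdiff_comm] at this
    rw [Finset.card_insert_of_notMem hv, pow_succ, mul_two, add_mul]
    by_cases hW : v ∈ W
    · refine (indepBetti_le_erase_add G hW).trans (add_le_add h1 (ih _ fun E hE => ?_))
      have := h (insert v E) (Finset.insert_subset_insert _ hE)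
      convert this using 2
      ext x
      simp only [mem_withoutNbrs, Finset.mem_sdiff, Finset.mem_erase,
        Finset.mem_insert, Finset.mem_singleton, forall_eq, forall_eq_or_imp]
      tauto
    · rw [Finset.erase_eq_of_notMem hW] at h1
      exact h1.trans (le_add_of_nonneg_right (by positivity))

end GraphBetti

/-! ### Decision trees on sets of binary digits -/

/-- A bound for the total Betti number of the independence complex of the graph whose vertices are
the positions of the binary digits `1` of `m`, where the digits of `nb i` mark the neighbours of
`i`. The graph without vertices contributes `1`, and a graph whose last vertex is isolated `0`.
Otherwise the graph is split at the last neighbour `w` of its last vertex, into the graph without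
`w` and the graph without `w` and its neighbours. The recursion has depth at most `k`, and the value
`B + 1` means that no bound was found; this includes splits at the vertex `0`, which is not in use
below.

The function is evaluated in the kernel. Therefore the operations on `ℕ` are those with built-in
evaluation, and each intermediate number is matched on, so that it is computed only once. -/
def treeBound (B : ℕ) (nb : ℕ → ℕ) : ℕ → ℕ → ℕ
  | 0, _ => B + 1
  | _ + 1, 0 => 1
  | k + 1, p + 1 =>
    match Nat.land (p + 1) (nb (Nat.log2 (p + 1))) with
    | 0 => 0
    | q + 1 =>
      match Nat.log2 (q + 1) with
      | 0 => B + 1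
      | w + 1 =>
        match Nat.xor (p + 1) (Nat.shiftLeft 1 (w + 1)) with
        | 0 => B + 1
        | r + 1 =>
          Nat.add (treeBound B nb k (r + 1))
            (treeBound B nb k (Nat.xor (r + 1) (Nat.land (r + 1) (nb (w + 1)))))

/-- Whether `treeBound` gives at most `B` for `m`, possibly after a first split at one of the
vertices in `ws`. -/
def boundedBy (B : ℕ) (nb : ℕ → ℕ) (ws : List ℕ) (k m : ℕ) : Bool :=
  (treeBound B nb k m).ble B || ws.any fun w =>
    m.testBit w &&
      (treeBound B nb k (Nat.xor m (Nat.shiftLeft 1 w)) +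
        treeBound B nb k (Nat.xor (Nat.xor m (Nat.shiftLeft 1 w))
          (Nat.land (Nat.xor m (Nat.shiftLeft 1 w)) (nb w)))).ble B

/-- Whether `boundedBy` holds for all digit sets that arise from `m` by removing the union of some
of the digit sets in a list. -/
def allBoundedBy (B : ℕ) (nb : ℕ → ℕ) (ws : List ℕ) (k : ℕ) : List ℕ → ℕ → Bool
  | [], m => boundedBy B nb ws k m
  | _ :: _, 0 => true
  | p :: ps, m + 1 =>
    allBoundedBy B nb ws k ps (m + 1) &&
      allBoundedBy B nb ws k ps (Nat.xor (m + 1) (Nat.land (m + 1) p))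

theorem testBit_xor_land (m n i : ℕ) :
    (Nat.xor m (Nat.land m n)).testBit i = (m.testBit i && !n.testBit i) := by
  change (m ^^^ (m &&& n)).testBit i = _
  rw [Nat.testBit_xor, Nat.testBit_and]
  cases m.testBit i <;> cases n.testBit i <;> rfl

theorem testBit_xor_shiftLeft {m w : ℕ} (hw : m.testBit w) (i : ℕ) :
    (Nat.xor m (Nat.shiftLeft 1 w)).testBit i = (m.testBit i && decide (w ≠ i)) := by
  change (m ^^^ (1 <<< w)).testBit i = _
  rw [Nat.testBit_xor, Nat.one_shiftLeft, Nat.testBit_two_pow]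
  by_cases h : w = i
  · subst h; simp [hw]
  · simp [h]

section Soundness

variable {V : Type*} [LinearOrder V]

/-- The image under `φ` of the set of positions of the binary digits `1` of `m`. -/
def bitImage (φ : ℕ → V) (m : ℕ) : Finset V := ((Finset.range m).filter (m.testBit ·)).image φ

theorem mem_bitImage {φ : ℕ → V} {m : ℕ} {x : V} :
    x ∈ bitImage φ m ↔ ∃ i, m.testBit i = true ∧ φ i = x := by
  simp only [bitImage, Finset.mem_image, Finset.mem_filter, Finset.mem_range]
  constructor
  · rintro ⟨i, ⟨-, h⟩, rfl⟩
    exact ⟨i, h, rfl⟩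
  · rintro ⟨i, h, rfl⟩
    exact ⟨i, ⟨Nat.lt_two_pow_self.trans_le (Nat.ge_two_pow_of_testBit h), h⟩, rfl⟩

theorem bitImage_zero (φ : ℕ → V) : bitImage φ 0 = ∅ := rfl

/-- The map `φ` embeds the graph on the digits of `f` given by the neighbour masks `nb` into `G` as
an induced subgraph, and no vertex of this subgraph belongs or is adjacent to the set `R`. -/
structure MaskEmbedding (G : SimpleGraph V) (nb : ℕ → ℕ) (f : ℕ) (φ : ℕ → V) (R : Finset V) :
    Prop where
  inj : ∀ i j, f.testBit i = true → f.testBit j = true → φ i = φ j → i = j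
  adj : ∀ i j, f.testBit i = true → f.testBit j = true →
    (G.Adj (φ i) (φ j) ↔ (nb i).testBit j = true)
  notMem : ∀ i, f.testBit i = true → φ i ∉ R
  notAdj : ∀ i, f.testBit i = true → ∀ x ∈ R, ¬ G.Adj (φ i) x

variable [Fintype V] {G : SimpleGraph V} [DecidableRel G.Adj] {nb : ℕ → ℕ} {f : ℕ} {φ : ℕ → V}
  {R : Finset V}

/-- The inequality `β(G) ≤ β(G - w) + β(G - N[w])` in terms of binary digits. -/
theorem MaskEmbedding.indepBetti_le_split (h : MaskEmbedding G nb f φ R) {m w : ℕ}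
    (hm : ∀ i, m.testBit i = true → f.testBit i = true) (hw : m.testBit w = true) :
    indepBetti G (bitImage φ m ∪ R) ≤
      indepBetti G (bitImage φ (Nat.xor m (Nat.shiftLeft 1 w)) ∪ R) +
      indepBetti G (bitImage φ (Nat.xor (Nat.xor m (Nat.shiftLeft 1 w))
        (Nat.land (Nat.xor m (Nat.shiftLeft 1 w)) (nb w))) ∪ R) := by
  have h1 : (bitImage φ m ∪ R).erase (φ w) =
      bitImage φ (Nat.xor m (Nat.shiftLeft 1 w)) ∪ R := by
    ext x
    simp only [Finset.mem_erase, Finset.mem_union, mem_bitImage, testBit_xor_shiftLeft hw,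
      Bool.and_eq_true, decide_eq_true_eq]
    constructor
    · rintro ⟨hx, ⟨i, hi, rfl⟩ | hR⟩
      · exact Or.inl ⟨i, ⟨hi, fun e => hx (e ▸ rfl)⟩, rfl⟩
      · exact Or.inr hR
    · rintro (⟨i, ⟨hi, hne⟩, rfl⟩ | hR)
      · exact ⟨fun e => hne (h.inj _ _ (hm _ hw) (hm _ hi) e.symm), Or.inl ⟨i, hi, rfl⟩⟩
      · exact ⟨fun e => h.notMem w (hm _ hw) (e ▸ hR), Or.inr hR⟩
  have h2 : withoutNbrs G ((bitImage φ m ∪ R).erase (φ w)) {φ w} =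
      bitImage φ (Nat.xor (Nat.xor m (Nat.shiftLeft 1 w))
        (Nat.land (Nat.xor m (Nat.shiftLeft 1 w)) (nb w))) ∪ R := by
    rw [h1]
    ext x
    simp only [mem_withoutNbrs, Finset.mem_singleton, forall_eq, Finset.mem_union, mem_bitImage,
      testBit_xor_land, testBit_xor_shiftLeft hw, Bool.and_eq_true, decide_eq_true_eq,
      Bool.not_eq_true', ← Bool.not_eq_true]
    constructor
    · rintro ⟨⟨i, hi, rfl⟩ | hR, ha⟩
      · exact Or.inl ⟨i, ⟨hi, fun e => ha ((h.adj _ _ (hm _ hw) (hm _ hi.1)).2 e)⟩, rfl⟩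
      · exact Or.inr hR
    · rintro (⟨i, ⟨hi, hn⟩, rfl⟩ | hR)
      · exact ⟨Or.inl ⟨i, hi, rfl⟩, fun ha => hn ((h.adj _ _ (hm _ hw) (hm _ hi.1)).1 ha)⟩
      · exact ⟨Or.inr hR, h.notAdj w (hm _ hw) x hR⟩
  have := indepBetti_le_erase_add G (W := bitImage φ m ∪ R) (v := φ w)
    (Finset.mem_union_left _ (mem_bitImage.2 ⟨w, hw, rfl⟩))
  rwa [h2, h1] at this

/-- The decision tree of a part of a graph can be carried out while the rest `R` is left alone: the
leaves without vertices in this part contribute the total Betti number of `R`, the others nothing. -/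
theorem MaskEmbedding.indepBetti_le_treeBound (h : MaskEmbedding G nb f φ R) (B k m : ℕ)
    (hm : ∀ i, m.testBit i = true → f.testBit i = true) (hB : treeBound B nb k m ≤ B) :
    indepBetti G (bitImage φ m ∪ R) ≤ treeBound B nb k m * indepBetti G R := by
  fun_induction treeBound B nb k m with
  | case1 => omega
  | case2 => simp [bitImage_zero]
  | case3 k p hq =>
    have hu : (p + 1).testBit (p + 1).log2 = true := Nat.testBit_log2 (Nat.succ_ne_zero p)
    rw [Nat.cast_zero, zero_mul]
    refine indepBetti_le_zero G (v := φ (p + 1).log2)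
      (Finset.mem_union_left _ (mem_bitImage.2 ⟨_, hu, rfl⟩)) fun x hx ha => ?_
    rcases Finset.mem_union.1 hx with hx | hx
    · obtain ⟨i, hi, rfl⟩ := mem_bitImage.1 hx
      have : ((p + 1) &&& nb (p + 1).log2).testBit i = true := by
        rw [Nat.testBit_and, hi, (h.adj _ _ (hm _ hu) (hm _ hi)).1 ha]; rfl
      rw [show (p + 1) &&& nb (p + 1).log2 = 0 from hq, Nat.zero_testBit] at this
      exact Bool.false_ne_true this
    · exact h.notAdj _ (hm _ hu) x hx ha
  | case4 => omega
  | case5 => omega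
  | case6 k p q hq w hw r hr ih1 ih2 =>
    rw [Nat.succ_eq_add_one] at hq hw hr hm
    have hwq : (q + 1).testBit (w + 1) = true := by
      rw [← hw]; exact Nat.testBit_log2 (Nat.succ_ne_zero q)
    have hwp : (p + 1).testBit (w + 1) = true := by
      rw [← hq] at hwq
      change ((p + 1) &&& nb (p + 1).log2).testBit (w + 1) = true at hwq
      rw [Nat.testBit_and, Bool.and_eq_true] at hwq
      exact hwq.1
    have hr' : ∀ i, (r + 1).testBit i = true → f.testBit i = true := fun i hi => by
      rw [← hr, testBit_xor_shiftLeft hwp, Bool.and_eq_true] at hi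
      exact hm i hi.1
    have hsplit := h.indepBetti_le_split hm hwp
    rw [hr] at hsplit
    rw [Nat.add_eq] at hB ⊢
    rw [Nat.cast_add, add_mul]
    refine hsplit.trans (add_le_add (ih1 hr' (by omega)) (ih2 (fun i hi => ?_) (by omega)))
    rw [testBit_xor_land, Bool.and_eq_true] at hi
    exact hr' i hi.1

theorem MaskEmbedding.indepBetti_le_of_boundedBy (h : MaskEmbedding G nb f φ R) {B : ℕ}
    {ws : List ℕ} {k m : ℕ} (hm : ∀ i, m.testBit i = true → f.testBit i = true)
    (hB : boundedBy B nb ws k m = true) {b : ℤ} (hb : 0 ≤ b) (hR : indepBetti G R ≤ b) :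
    indepBetti G (bitImage φ m ∪ R) ≤ B * b := by
  have key : ∀ n : ℕ, n ≤ B → (n : ℤ) * indepBetti G R ≤ B * b := fun n hn =>
    (mul_le_mul_of_nonneg_left hR (Int.natCast_nonneg n)).trans
      (mul_le_mul_of_nonneg_right (by exact_mod_cast hn) hb)
  rw [boundedBy, Bool.or_eq_true, List.any_eq_true] at hB
  rcases hB with hB | ⟨w, -, hB⟩
  · have hB := Nat.le_of_ble_eq_true hB
    exact (h.indepBetti_le_treeBound B k m hm hB).trans (key _ hB)
  · rw [Bool.and_eq_true] at hB
    obtain ⟨hw, hB⟩ := hB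
    have hB := Nat.le_of_ble_eq_true hB
    have h1 : ∀ i, (Nat.xor m (Nat.shiftLeft 1 w)).testBit i = true → f.testBit i = true :=
      fun i hi => by
        rw [testBit_xor_shiftLeft hw, Bool.and_eq_true] at hi
        exact hm i hi.1
    refine (h.indepBetti_le_split hm hw).trans ((add_le_add
      (h.indepBetti_le_treeBound B k _ h1 (by omega))
      (h.indepBetti_le_treeBound B k _ (fun i hi => ?_) (by omega))).trans ?_)
    · rw [testBit_xor_land, Bool.and_eq_true] at hi
      exact h1 i hi.1
    · rw [← add_mul, ← Nat.cast_add]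
      exact key _ hB

end Soundness

/-- If `allBoundedBy` holds, then for every choice `c` among the digit sets in `ps` the digits of
`f` outside the chosen sets form a digit set for which `boundedBy` holds. -/
theorem exists_boundedBy {B : ℕ} {nb : ℕ → ℕ} {ws : List ℕ} {k : ℕ} (hB : 1 ≤ B) (hk : 1 ≤ k)
    (ps : List ℕ) (f : ℕ) (h : allBoundedBy B nb ws k ps f = true) (c : ℕ → Prop) :
    ∃ m, boundedBy B nb ws k m = true ∧
      ∀ i, m.testBit i = true ↔ f.testBit i = true ∧ ∀ p ∈ ps, c p → ¬ p.testBit i = true := by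
  fun_induction allBoundedBy B nb ws k ps f with
  | case1 m => exact ⟨m, h, by simp⟩
  | case2 =>
    refine ⟨0, ?_, by simp⟩
    obtain ⟨k, rfl⟩ := Nat.exists_eq_add_of_le' hk
    simp [boundedBy, treeBound, hB]
  | case3 p ps m ih1 ih2 =>
    rw [Bool.and_eq_true] at h
    by_cases hp : c p
    · obtain ⟨n, hn, hi⟩ := ih2 h.2
      refine ⟨n, hn, fun i => ?_⟩
      rw [hi, testBit_xor_land]
      simp [hp, and_assoc]
    · obtain ⟨n, hn, hi⟩ := ih1 h.1
      refine ⟨n, hn, fun i => ?_⟩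
      rw [hi]
      simp [hp]

/-! ### The cell of the tiling -/

/-- Being a vertex of the Kagome lattice. -/
def IsKagome (p : ℤ × ℤ) : Prop := Odd p.1 ∨ Odd p.2 ∨ Odd (p.1 + p.2)

/-- Adjacency in the Kagome lattice. -/
def KagomeAdj (p q : ℤ × ℤ) : Prop :=
  hexNorm (q - p) = 1 ∧ ((p.1 = q.1 ∧ Odd p.1) ∨ (p.2 = q.2 ∧ Odd p.2) ∨
    (p.1 + p.2 = q.1 + q.2 ∧ Odd (p.1 + p.2)))

instance : DecidablePred IsKagome := fun _ => inferInstanceAs (Decidable (_ ∨ _))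

instance : DecidableRel KagomeAdj := fun _ _ => inferInstanceAs (Decidable (_ ∧ _))

/-- The number `8 (a + 4) + (b + 4)` encodes the lattice point `(a, b)`; this is the point with a
given number. -/
def gridPoint (i : ℕ) : ℤ × ℤ := ((i / 8 : ℕ) - 4, (i % 8 : ℕ) - 4)

/-- The numbers of the four neighbours in the Kagome lattice of the point with number `i`, as
binary digits. The differences of the numbers are `±8, ±7` if `a` is even, `±1, ±7` if `b` is even,
and `±1, ±8` if both are odd; the constants have the digits `9 + δ` for these differences `δ`. -/
def nbrMask (i : ℕ) : ℕ :=
  Nat.shiftRight (Nat.shiftLeft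
    (bif i / 8 % 2 == 0 then 196614 else bif i % 2 == 0 then 66820 else 132354) i) 9

/-- The numbers of the 30 vertices of the large hexagon centred at the origin, as binary digits. -/
def tileMask : ℕ := 2173689043008155648

/-- The 12 vertices outside the large hexagon at the origin that have neighbours in it, with the
numbers of these neighbours as binary digits. -/
def outerVertices : List ((ℤ × ℤ) × ℕ) :=
  [((-4, 1), 12288), ((-4, 3), 49152), ((-3, -1), 528384), ((-3, 4), 8421376),
    ((-1, -3), 8657043456), ((-1, 4), 551903297536), ((1, -4), 2207613190144),
    ((1, 3), 70918499991552), ((3, -4), 144678138029277184), ((3, 1), 1161928703861587968),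
    ((4, -3), 432345564227567616), ((4, -1), 1729382256910270464)]

/-- Representatives of the vertices outside all large hexagons of a tiling, modulo the translations
of the tiling. -/
def gapVertices : Finset (ℤ × ℤ) := {(1, 3), (3, 1), (4, -1), (4, -3), (3, -4), (1, -4)}

/-- The vertices of the large hexagon centred at the origin. -/
def tileVertices : Finset (ℤ × ℤ) :=
  ((Finset.range 64).filter (tileMask.testBit ·)).image gridPoint

theorem tileMask_lt {i : ℕ} (h : tileMask.testBit i = true) : i < 64 := by
  by_contra hi
  have h2 : tileMask < 2 ^ i :=
    lt_of_lt_of_le (by decide : tileMask < 2 ^ 64) (Nat.pow_le_pow_right (by norm_num) (by omega))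
  rw [Nat.testBit_lt_two_pow h2] at h
  exact Bool.false_ne_true h

theorem gridPoint_injective : Function.Injective gridPoint := by
  intro i j h
  simp only [gridPoint, Prod.mk.injEq] at h
  omega

theorem mem_tileVertices {p : ℤ × ℤ} :
    p ∈ tileVertices ↔ ∃ i, tileMask.testBit i = true ∧ gridPoint i = p := by
  simp only [tileVertices, Finset.mem_image, Finset.mem_filter, Finset.mem_range]
  exact ⟨fun ⟨i, h, e⟩ => ⟨i, h.2, e⟩, fun ⟨i, h, e⟩ => ⟨i, ⟨tileMask_lt h, h⟩, e⟩⟩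

theorem tileVertices_spec : ∀ p ∈ tileVertices, IsKagome p ∧ hexNorm p ≤ 3 := by
  decide +kernel

theorem gapVertices_spec : ∀ p ∈ gapVertices, IsKagome p ∧ 3 < hexNorm p := by
  decide +kernel

theorem hexNorm_le {p : ℤ × ℤ} {r : ℤ} :
    hexNorm p ≤ r ↔ (-r ≤ p.1 ∧ p.1 ≤ r) ∧ (-r ≤ p.2 ∧ p.2 ≤ r) ∧
      (-r ≤ p.1 + p.2 ∧ p.1 + p.2 ≤ r) := by
  simp only [hexNorm, max_le_iff, abs_le, and_assoc]

theorem mem_tileVertices_of_hexNorm_le {p : ℤ × ℤ} (hp : IsKagome p) (h : hexNorm p ≤ 3) :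
    p ∈ tileVertices := by
  have key : ∀ a ∈ Finset.Icc (-3 : ℤ) 3, ∀ b ∈ Finset.Icc (-3 : ℤ) 3,
      IsKagome (a, b) → hexNorm (a, b) ≤ 3 → (a, b) ∈ tileVertices := by
    decide +kernel
  obtain ⟨⟨h1, h2⟩, ⟨h3, h4⟩, -⟩ := hexNorm_le.1 h
  exact key p.1 (Finset.mem_Icc.2 ⟨h1, h2⟩) p.2 (Finset.mem_Icc.2 ⟨h3, h4⟩) hp h

theorem kagomeAdj_gridPoint_iff {i j : ℕ} (hi : tileMask.testBit i = true)
    (hj : tileMask.testBit j = true) :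
    KagomeAdj (gridPoint i) (gridPoint j) ↔ (nbrMask i).testBit j = true := by
  have key : ∀ i < 64, tileMask.testBit i = true → ∀ j < 64, tileMask.testBit j = true →
      (KagomeAdj (gridPoint i) (gridPoint j) ↔ (nbrMask i).testBit j = true) := by
    decide +kernel
  exact key i (tileMask_lt hi) hi j (tileMask_lt hj) hj

theorem kagomeAdj_outerVertices_iff {x : (ℤ × ℤ) × ℕ} (hx : x ∈ outerVertices) {i : ℕ}
    (hi : tileMask.testBit i = true) :
    KagomeAdj x.1 (gridPoint i) ↔ x.2.testBit i = true := by
  have key : ∀ x ∈ outerVertices, ∀ i < 64, tileMask.testBit i = true →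
      (KagomeAdj x.1 (gridPoint i) ↔ x.2.testBit i = true) := by
    decide +kernel
  exact key x hx i (tileMask_lt hi) hi

theorem isKagome_of_mem_outerVertices : ∀ x ∈ outerVertices, IsKagome x.1 := by
  decide +kernel

theorem exists_mem_outerVertices {p q : ℤ × ℤ} (h : KagomeAdj p q) (hp : 3 < hexNorm p)
    (hq : q ∈ tileVertices) : ∃ x ∈ outerVertices, x.1 = p := by
  have key : ∀ q ∈ tileVertices, ∀ a ∈ Finset.Icc (-1 : ℤ) 1, ∀ b ∈ Finset.Icc (-1 : ℤ) 1,
      KagomeAdj (q - (a, b)) q → 3 < hexNorm (q - (a, b)) →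
      ∃ x ∈ outerVertices, x.1 = q - (a, b) := by
    decide +kernel
  obtain ⟨⟨h1, h2⟩, ⟨h3, h4⟩, -⟩ := hexNorm_le.1 h.1.le
  have e : q - ((q - p).1, (q - p).2) = p := sub_sub_cancel q p
  have := key q hq _ (Finset.mem_Icc.2 ⟨h1, h2⟩) _ (Finset.mem_Icc.2 ⟨h3, h4⟩)
  rw [e] at this
  exact this h hp

theorem mem_tilingLattice {p : ℤ × ℤ} : p ∈ tilingLattice ↔ 4 ∣ p.1 ∧ 12 ∣ p.2 - p.1 := by
  rw [tilingLattice, AddSubgroup.mem_closure_pair]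
  constructor
  · rintro ⟨m, n, rfl⟩
    simp only [Prod.smul_mk, smul_eq_mul, Prod.mk_add_mk]
    omega
  · rintro ⟨⟨k, hk⟩, ⟨l, hl⟩⟩
    refine ⟨k + l, l, ?_⟩
    ext <;> simp <;> omega

theorem mem_kagomeTranslations {p : ℤ × ℤ} : p ∈ kagomeTranslations ↔ Even p.1 ∧ Even p.2 := by
  rw [kagomeTranslations, AddSubgroup.mem_closure_pair]
  constructor
  · rintro ⟨m, n, rfl⟩
    simp
  · rintro ⟨⟨k, hk⟩, ⟨l, hl⟩⟩
    refine ⟨k, l, ?_⟩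
    ext <;> simp <;> omega

theorem card_tileVertices_union_gapVertices : (tileVertices ∪ gapVertices).card = 36 := by
  decide +kernel

/-- The 36 vertices of a cell are pairwise inequivalent under the translations of the tiling. -/
theorem eq_of_sub_mem_tilingLattice {p q : ℤ × ℤ} (hp : p ∈ tileVertices ∪ gapVertices)
    (hq : q ∈ tileVertices ∪ gapVertices) (h : p - q ∈ tilingLattice) : p = q := by
  have key : ∀ p ∈ tileVertices ∪ gapVertices, ∀ q ∈ tileVertices ∪ gapVertices,
      4 ∣ (p - q).1 → 12 ∣ (p - q).2 - (p - q).1 → p = q := by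
    decide +kernel
  rw [mem_tilingLattice] at h
  exact key p hp q hq h.1 h.2

/-- Every vertex of the Kagome lattice is a translate of a vertex of the cell. -/
theorem exists_sub_mem_tilingLattice {p : ℤ × ℤ} (hp : IsKagome p) :
    ∃ r ∈ tileVertices ∪ gapVertices, p - r ∈ tilingLattice := by
  have key : ∀ a ∈ Finset.Ico (0 : ℤ) 12, ∀ b ∈ Finset.Ico (0 : ℤ) 12, IsKagome (a, b) →
      ∃ r ∈ tileVertices ∪ gapVertices, 4 ∣ a - r.1 ∧ 12 ∣ (b - r.2) - (a - r.1) := by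
    decide +kernel
  have h12 : ∀ z : ℤ, z % 12 ∈ Finset.Ico (0 : ℤ) 12 := fun z => by
    rw [Finset.mem_Ico]; omega
  obtain ⟨r, hr, h1, h2⟩ := key (p.1 % 12) (h12 _) (p.2 % 12) (h12 _) (by
    simp only [IsKagome, Int.odd_iff] at hp ⊢
    omega)
  refine ⟨r, hr, mem_tilingLattice.2 ?_⟩
  rw [Prod.fst_sub, Prod.snd_sub]
  omega

/-- Distinct large hexagons of a tiling are not adjacent: nonzero translations of the tiling have
length at least `8`. -/
theorem eq_zero_of_mem_tilingLattice {p q t : ℤ × ℤ} (ht : t ∈ tilingLattice)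
    (hp : hexNorm p ≤ 3) (hq : hexNorm q ≤ 3) (h : hexNorm (t + q - p) ≤ 1) : t = 0 := by
  rw [mem_tilingLattice] at ht
  rw [hexNorm_le] at hp hq h
  simp only [Prod.fst_sub, Prod.fst_add, Prod.snd_sub, Prod.snd_add] at h
  have h1 : -7 ≤ t.1 ∧ t.1 ≤ 7 := by omega
  have h2 : -7 ≤ t.2 ∧ t.2 ≤ 7 := by omega
  have h3 : -7 ≤ t.1 + t.2 ∧ t.1 + t.2 ≤ 7 := by omega
  clear hp hq h
  ext
  · rw [Prod.fst_zero]; omega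
  · rw [Prod.snd_zero]; omega

/-- All `2 ^ 12` graphs obtained from the large hexagon by removing the neighbours of some of the
surrounding vertices have a decision tree with at most 14 leaves that contribute. A few of
them need a first split at one of the vertices `(0, 1)`, `(2, 1)` and `(2, -1)`, which are numbered
`37`, `53` and `51`. The depth `31` suffices because there are only 30 vertices. -/
theorem allBoundedBy_tileMask :
    allBoundedBy 14 nbrMask [37, 53, 51] 31 (outerVertices.map Prod.snd) tileMask = true := by
  decide +kernel

/-! ### Quotients of the Kagome lattice -/

section Quotient

variable (Λ : AddSubgroup (ℤ × ℤ))

/-- The class in the quotient by `Λ` of a vertex of the Kagome lattice; other lattice points are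
sent to a fixed class. -/
noncomputable def vertexClass (p : ℤ × ℤ) : HexDimerVertex Λ :=
  if h : IsKagome p then Quotient.mk _ ⟨p, h⟩ else Quotient.mk _ ⟨(1, 0), Or.inl odd_one⟩

theorem vertexClass_of_isKagome {p : ℤ × ℤ} (hp : IsKagome p) :
    vertexClass Λ p = Quotient.mk (translationSetoid Λ) ⟨p, hp⟩ :=
  dif_pos hp

theorem exists_vertexClass_eq (x : HexDimerVertex Λ) : ∃ p, IsKagome p ∧ vertexClass Λ p = x := by
  obtain ⟨⟨p, hp⟩, rfl⟩ := Quotient.exists_rep x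
  exact ⟨p, hp, vertexClass_of_isKagome Λ hp⟩

variable {Λ}

theorem vertexClass_eq_iff {p q : ℤ × ℤ} (hp : IsKagome p) (hq : IsKagome q) :
    vertexClass Λ p = vertexClass Λ q ↔ q - p ∈ Λ := by
  rw [vertexClass_of_isKagome Λ hp, vertexClass_of_isKagome Λ hq]
  exact Quotient.eq

theorem IsKagome.add_translation {p t : ℤ × ℤ} (hp : IsKagome p) (ht : t ∈ kagomeTranslations) :
    IsKagome (t + p) := by
  rw [mem_kagomeTranslations] at ht
  simp only [IsKagome, Prod.fst_add, Prod.snd_add, Int.odd_iff, Int.even_iff] at *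
  omega

theorem KagomeAdj.add_translation {p q t : ℤ × ℤ} (h : KagomeAdj p q)
    (ht : t ∈ kagomeTranslations) : KagomeAdj (t + p) (t + q) := by
  rw [mem_kagomeTranslations] at ht
  refine ⟨by rw [add_sub_add_left_eq_sub]; exact h.1, ?_⟩
  have := h.2
  simp only [Prod.fst_add, Prod.snd_add, Int.odd_iff, Int.even_iff] at *
  omega

theorem adj_vertexClass_iff (hΛ : Λ ≤ kagomeTranslations) {p q : ℤ × ℤ} (hp : IsKagome p)
    (hq : IsKagome q) : (hexDimer Λ).Adj (vertexClass Λ p) (vertexClass Λ q) ↔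
      q - p ∉ Λ ∧ ∃ l ∈ Λ, KagomeAdj p (l + q) := by
  rw [← vertexClass_eq_iff hp hq]
  refine and_congr_right fun _ => ⟨?_, ?_⟩
  · rintro ⟨⟨p', hp'⟩, ⟨q', hq'⟩, ep, eq, h⟩
    replace ep := (vertexClass_eq_iff hp' hp).1 ((vertexClass_of_isKagome Λ hp').trans ep)
    replace eq := (vertexClass_eq_iff hq' hq).1 ((vertexClass_of_isKagome Λ hq').trans eq)
    refine ⟨(p - p') - (q - q'), Λ.sub_mem ep eq, ?_⟩
    have h' : KagomeAdj p' q' := h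
    have := h'.add_translation (hΛ ep)
    rwa [sub_add_cancel, show p - p' + q' = p - p' - (q - q') + q by abel] at this
  · rintro ⟨l, hl, h⟩
    have hq' := hq.add_translation (hΛ hl)
    refine ⟨⟨p, hp⟩, ⟨l + q, hq'⟩, (vertexClass_of_isKagome Λ hp).symm,
      (vertexClass_of_isKagome Λ hq').symm.trans ((vertexClass_eq_iff hq' hq).2 ?_), h⟩
    rw [sub_add_cancel_right]
    exact Λ.neg_mem hl

end Quotient

theorem tilingLattice_le : tilingLattice ≤ kagomeTranslations := fun p hp => by
  rw [mem_tilingLattice] at hp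
  rw [mem_kagomeTranslations, Int.even_iff, Int.even_iff]
  omega

/-- A translation that preserves a tiling by large hexagons is a translation of the tiling. -/
theorem le_tilingLattice_of_tileable {Λ : AddSubgroup (ℤ × ℤ)} {c : ℤ × ℤ}
    (hΛ : Λ ≤ kagomeTranslations) (hc : c ∈ kagomeTranslations)
    (h : ∀ l ∈ Λ, ∀ T ∈ hexTiling c, translateTile l T ∈ hexTiling c) : Λ ≤ tilingLattice := by
  intro l hl
  obtain ⟨s, hs, e⟩ := h l hl _ ⟨0, tilingLattice.zero_mem, rfl⟩
  have key : ∀ r, IsKagome r → hexNorm r ≤ 3 → hexNorm (l - s + r) ≤ 3 := by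
    intro r hk hn
    have hK : IsKagome (l + (c + r)) := (hk.add_translation hc).add_translation (hΛ hl)
    have hmem : (⟨l + (c + r), hK⟩ : KagomeVertex) ∈ translateTile l (largeHexagon (c + 0)) :=
      ⟨⟨c + r, hk.add_translation hc⟩, by
        change hexNorm (c + r - (c + 0)) ≤ 3
        rwa [add_zero, add_sub_cancel_left], rfl⟩
    rw [e] at hmem
    have h3 : hexNorm (l + (c + r) - (c + s)) ≤ 3 := hmem
    rwa [show l + (c + r) - (c + s) = l - s + r by abel] at h3
  -- Four corners of the tile at `c` determine its centre.
  have h1 := key (3, 0) (by decide) (by decide)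
  have h2 := key (-3, 0) (by decide) (by decide)
  have h3 := key (0, 3) (by decide) (by decide)
  have h4 := key (0, -3) (by decide) (by decide)
  simp only [hexNorm_le, Prod.fst_add, Prod.snd_add] at h1 h2 h3 h4
  have : l - s = 0 := by
    ext
    · rw [Prod.fst_zero]; omega
    · rw [Prod.snd_zero]; omega
  rw [sub_eq_zero.1 this]
  exact hs

/-- A set of representatives of the large hexagons of a tiling modulo `Λ`. -/
structure IsTransversal (Λ : AddSubgroup (ℤ × ℤ)) (S : Finset (ℤ × ℤ)) : Prop where
  mem : ∀ s ∈ S, s ∈ tilingLattice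
  exists_sub_mem : ∀ t ∈ tilingLattice, ∃ s ∈ S, s - t ∈ Λ
  eq_of_sub_mem : ∀ s ∈ S, ∀ t ∈ S, s - t ∈ Λ → s = t

theorem exists_isTransversal {Λ : AddSubgroup (ℤ × ℤ)} [Finite (HexDimerVertex Λ)] :
    ∃ S, IsTransversal Λ S := by
  have hK : ∀ t ∈ tilingLattice, IsKagome (t + (1, 0)) := fun t ht =>
    IsKagome.add_translation (Or.inl odd_one) (tilingLattice_le ht)
  obtain ⟨S, hS, hbij⟩ := Set.exists_subset_bijOn (tilingLattice : Set (ℤ × ℤ))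
    fun t => vertexClass Λ (t + (1, 0))
  have hfin : S.Finite := Set.Finite.of_injOn hbij.mapsTo hbij.injOn (Set.toFinite _)
  have hsub : ∀ s t : ℤ × ℤ, t + (1, 0) - (s + (1, 0)) = t - s := fun s t => by abel
  refine ⟨hfin.toFinset, fun s hs => hS (hfin.mem_toFinset.1 hs), fun t ht => ?_,
    fun s hs t ht h => ?_⟩
  · obtain ⟨s, hs, e⟩ := hbij.surjOn ⟨t, ht, rfl⟩
    refine ⟨s, hfin.mem_toFinset.2 hs, ?_⟩
    have e' := (vertexClass_eq_iff (hK t ht) (hK s (hS hs))).1 e.symm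
    rwa [hsub] at e'
  · rw [hfin.mem_toFinset] at hs ht
    refine (hbij.injOn ht hs ((vertexClass_eq_iff (hK t (hS ht)) (hK s (hS hs))).2 ?_)).symm
    rwa [hsub]

section Cells

variable {Λ : AddSubgroup (ℤ × ℤ)} {S : Finset (ℤ × ℤ)} {c : ℤ × ℤ}

theorem isKagome_of_mem_cell {s r : ℤ × ℤ} (hc : c ∈ kagomeTranslations) (hs : s ∈ tilingLattice)
    (hr : r ∈ tileVertices ∪ gapVertices) : IsKagome (c + s + r) := by
  refine IsKagome.add_translation ?_ (AddSubgroup.add_mem _ hc (tilingLattice_le hs))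
  rcases Finset.mem_union.1 hr with hr | hr
  · exact (tileVertices_spec r hr).1
  · exact (gapVertices_spec r hr).1

theorem IsTransversal.eq_of_vertexClass_eq (hS : IsTransversal Λ S) (hΛ : Λ ≤ tilingLattice)
    (hc : c ∈ kagomeTranslations) {s s' r r' : ℤ × ℤ} (hs : s ∈ S) (hs' : s' ∈ S)
    (hr : r ∈ tileVertices ∪ gapVertices) (hr' : r' ∈ tileVertices ∪ gapVertices)
    (h : vertexClass Λ (c + s + r) = vertexClass Λ (c + s' + r')) : s = s' ∧ r = r' := by
  rw [vertexClass_eq_iff (isKagome_of_mem_cell hc (hS.mem s hs) hr)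
    (isKagome_of_mem_cell hc (hS.mem s' hs') hr')] at h
  have hrr : r = r' := by
    refine (eq_of_sub_mem_tilingLattice hr' hr ?_).symm
    have := tilingLattice.add_mem (hΛ h) (tilingLattice.sub_mem (hS.mem s hs) (hS.mem s' hs'))
    rwa [show c + s' + r' - (c + s + r) + (s - s') = r' - r by abel] at this
  subst hrr
  refine ⟨(hS.eq_of_sub_mem s' hs' s hs ?_).symm, rfl⟩
  rwa [show c + s' + r - (c + s + r) = s' - s by abel] at h

theorem IsTransversal.exists_vertexClass_eq (hS : IsTransversal Λ S)
    (hc : c ∈ kagomeTranslations) (x : HexDimerVertex Λ) :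
    ∃ s ∈ S, ∃ r ∈ tileVertices ∪ gapVertices, vertexClass Λ (c + s + r) = x := by
  obtain ⟨p, hp, rfl⟩ := HexDimer.exists_vertexClass_eq Λ x
  have hp' : IsKagome (-c + p) := hp.add_translation (AddSubgroup.neg_mem _ hc)
  obtain ⟨r, hr, ht⟩ := exists_sub_mem_tilingLattice hp'
  obtain ⟨s, hs, hl⟩ := hS.exists_sub_mem _ ht
  refine ⟨s, hs, r, hr, ?_⟩
  rw [vertexClass_eq_iff (isKagome_of_mem_cell hc (hS.mem s hs) hr) hp]
  have := Λ.neg_mem hl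
  rwa [show -(s - (-c + p - r)) = p - (c + s + r) by abel] at this

theorem IsTransversal.card_mul_le [Fintype (HexDimerVertex Λ)] (hS : IsTransversal Λ S)
    (hΛ : Λ ≤ tilingLattice) (hc : c ∈ kagomeTranslations) :
    S.card * 36 ≤ Fintype.card (HexDimerVertex Λ) := by
  rw [← card_tileVertices_union_gapVertices, ← Finset.card_product, ← Finset.card_univ]
  refine Finset.card_le_card_of_injOn (fun x => vertexClass Λ (c + x.1 + x.2))
    (fun _ _ => Finset.mem_coe.2 (Finset.mem_univ _)) ?_
  intro x hx y hy h
  rw [Finset.mem_coe, Finset.mem_product] at hx hy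
  exact Prod.ext_iff.2 (hS.eq_of_vertexClass_eq hΛ hc hx.1 hy.1 hx.2 hy.2 h)

end Cells

/-! ### Cutting the quotient into tiles -/

section Cells

variable {Λ : AddSubgroup (ℤ × ℤ)} {S : Finset (ℤ × ℤ)} {c : ℤ × ℤ}

/-- The embedding of the large hexagon centred at `c + s` into the quotient. -/
noncomputable def tileMap (Λ : AddSubgroup (ℤ × ℤ)) (c s : ℤ × ℤ) (i : ℕ) : HexDimerVertex Λ :=
  vertexClass Λ (c + s + gridPoint i)

theorem gridPoint_mem_cell {i : ℕ} (hi : tileMask.testBit i = true) :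
    gridPoint i ∈ tileVertices ∪ gapVertices :=
  Finset.mem_union_left _ (mem_tileVertices.2 ⟨i, hi, rfl⟩)

theorem hexNorm_gridPoint_le {i : ℕ} (hi : tileMask.testBit i = true) :
    hexNorm (gridPoint i) ≤ 3 :=
  (tileVertices_spec _ (mem_tileVertices.2 ⟨i, hi, rfl⟩)).2

/-- Tiles are embedded as induced subgraphs, and there are no edges between different tiles. -/
theorem IsTransversal.adj_tileMap_iff (hS : IsTransversal Λ S) (hΛ : Λ ≤ tilingLattice)
    (hc : c ∈ kagomeTranslations) {s t : ℤ × ℤ} (hs : s ∈ S) (ht : t ∈ S) {i j : ℕ}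
    (hi : tileMask.testBit i = true) (hj : tileMask.testBit j = true) :
    (hexDimer Λ).Adj (tileMap Λ c s i) (tileMap Λ c t j) ↔
      s = t ∧ KagomeAdj (gridPoint i) (gridPoint j) := by
  have hcs : ∀ s ∈ S, c + s ∈ kagomeTranslations := fun s hs =>
    AddSubgroup.add_mem _ hc (tilingLattice_le (hS.mem s hs))
  rw [tileMap, tileMap, adj_vertexClass_iff (hΛ.trans tilingLattice_le)
    (isKagome_of_mem_cell hc (hS.mem s hs) (gridPoint_mem_cell hi))
    (isKagome_of_mem_cell hc (hS.mem t ht) (gridPoint_mem_cell hj))]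
  constructor
  · rintro ⟨-, l, hl, h⟩
    have h0 : t + l - s = 0 := by
      refine eq_zero_of_mem_tilingLattice (tilingLattice.sub_mem
        (tilingLattice.add_mem (hS.mem t ht) (hΛ hl)) (hS.mem s hs)) (hexNorm_gridPoint_le hi)
        (hexNorm_gridPoint_le hj) ?_
      have := h.1.le
      rwa [show l + (c + t + gridPoint j) - (c + s + gridPoint i) =
        t + l - s + gridPoint j - gridPoint i by abel] at this
    refine ⟨hS.eq_of_sub_mem s hs t ht ?_, ?_⟩
    · rwa [show s - t = l by rw [← sub_eq_zero, ← neg_eq_zero, ← h0]; abel]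
    · have := h.add_translation (AddSubgroup.neg_mem _ (hcs s hs))
      rwa [neg_add_cancel_left, show -(c + s) + (l + (c + t + gridPoint j)) =
        t + l - s + gridPoint j by abel, h0, zero_add] at this
  · rintro ⟨rfl, h⟩
    refine ⟨fun hmem => ?_, 0, Λ.zero_mem, ?_⟩
    · rw [add_sub_add_left_eq_sub] at hmem
      have := eq_of_sub_mem_tilingLattice (gridPoint_mem_cell hj) (gridPoint_mem_cell hi)
        (hΛ hmem)
      have h1 := h.1
      rw [this, sub_self] at h1
      simp [hexNorm] at h1
    · rw [zero_add]
      exact h.add_translation (hcs s hs)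

variable [LinearOrder (HexDimerVertex Λ)]

/-- The classes of the vertices that belong to no large hexagon of the tiling. -/
noncomputable def gapClasses (Λ : AddSubgroup (ℤ × ℤ)) [LinearOrder (HexDimerVertex Λ)]
    (S : Finset (ℤ × ℤ)) (c : ℤ × ℤ) : Finset (HexDimerVertex Λ) :=
  (S ×ˢ gapVertices).image fun x => vertexClass Λ (c + x.1 + x.2)

theorem card_gapClasses_le : (gapClasses Λ S c).card ≤ S.card * 6 := by
  refine Finset.card_image_le.trans ?_
  rw [Finset.card_product]
  exact le_of_eq rfl

theorem mem_gapClasses {x : HexDimerVertex Λ} : x ∈ gapClasses Λ S c ↔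
    ∃ s ∈ S, ∃ r ∈ gapVertices, vertexClass Λ (c + s + r) = x := by
  simp only [gapClasses, Finset.mem_image, Finset.mem_product]
  exact ⟨fun ⟨y, h, e⟩ => ⟨y.1, h.1, y.2, h.2, e⟩, fun ⟨s, hs, r, hr, e⟩ => ⟨(s, r), ⟨hs, hr⟩, e⟩⟩

variable [Fintype (HexDimerVertex Λ)] [DecidableRel (hexDimer Λ).Adj]

/-- For a set `E` of vertices outside the tiles, the graph without the vertices outside the tiles
and without the neighbours of `E` is the union of the tiles without the neighbours of `E`. -/
theorem IsTransversal.withoutNbrs_eq_biUnion (hS : IsTransversal Λ S) (hΛ : Λ ≤ tilingLattice)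
    (hc : c ∈ kagomeTranslations) {E : Finset (HexDimerVertex Λ)} (hE : E ⊆ gapClasses Λ S c)
    {m : ℤ × ℤ → ℕ}
    (hm : ∀ s i, (m s).testBit i = true ↔ tileMask.testBit i = true ∧
      ∀ x ∈ outerVertices, vertexClass Λ (c + s + x.1) ∈ E → ¬ x.2.testBit i = true) :
    withoutNbrs (hexDimer Λ) (Finset.univ \ gapClasses Λ S c) E =
      S.biUnion fun s => bitImage (tileMap Λ c s) (m s) := by
  have hcs : ∀ s ∈ S, c + s ∈ kagomeTranslations := fun s hs =>
    AddSubgroup.add_mem _ hc (tilingLattice_le (hS.mem s hs))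
  ext x
  simp only [mem_withoutNbrs, Finset.mem_sdiff, Finset.mem_univ, true_and, Finset.mem_biUnion,
    mem_bitImage, mem_gapClasses]
  constructor
  · rintro ⟨hx, ha⟩
    obtain ⟨s, hs, r, hr, rfl⟩ := hS.exists_vertexClass_eq hc x
    rcases Finset.mem_union.1 hr with hr' | hr'
    · obtain ⟨i, hi, rfl⟩ := mem_tileVertices.1 hr'
      refine ⟨s, hs, i, (hm s i).2 ⟨hi, fun y hy hyE hbit => ha _ hyE ?_⟩, rfl⟩
      have hadj := (kagomeAdj_outerVertices_iff hy hi).2 hbit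
      have hyK := (isKagome_of_mem_outerVertices y hy).add_translation (hcs s hs)
      rw [adj_vertexClass_iff (hΛ.trans tilingLattice_le) hyK
        (isKagome_of_mem_cell hc (hS.mem s hs) hr), ← vertexClass_eq_iff hyK
        (isKagome_of_mem_cell hc (hS.mem s hs) hr)]
      refine ⟨fun e => hx ?_, 0, Λ.zero_mem, by
        rw [zero_add]; exact hadj.add_translation (hcs s hs)⟩
      obtain ⟨s', hs', r', hr', e'⟩ := mem_gapClasses.1 (hE hyE)
      exact ⟨s', hs', r', hr', e'.trans e⟩
    · exact absurd ⟨s, hs, r, hr', rfl⟩ hx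
  · rintro ⟨s, hs, i, hi, rfl⟩
    obtain ⟨hi, hmi⟩ := (hm s i).1 hi
    have hgap : ∀ r ∈ gapVertices, r ≠ gridPoint i := fun r hr e =>
      ((gapVertices_spec r hr).2.trans_le (e ▸ hexNorm_gridPoint_le hi)).false
    constructor
    · rintro ⟨s', hs', r', hr', e⟩
      exact hgap r' hr' (hS.eq_of_vertexClass_eq hΛ hc hs' hs (Finset.mem_union_right _ hr')
        (gridPoint_mem_cell hi) e).2
    · intro d hd hadj
      obtain ⟨s', hs', r, hr, rfl⟩ := mem_gapClasses.1 (hE hd)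
      have hrK := isKagome_of_mem_cell hc (hS.mem s' hs') (Finset.mem_union_right _ hr)
      rw [tileMap, adj_vertexClass_iff (hΛ.trans tilingLattice_le) hrK
        (isKagome_of_mem_cell hc (hS.mem s hs) (gridPoint_mem_cell hi))] at hadj
      obtain ⟨-, l, hl, h⟩ := hadj
      -- `p` is the position, relative to the tile, of the neighbour `d`.
      set p := s' + r - s - l with hp
      have hpK : KagomeAdj p (gridPoint i) := by
        have := h.add_translation (AddSubgroup.neg_mem _
          (AddSubgroup.add_mem _ (hcs s hs) (tilingLattice_le (hΛ hl))))
        rwa [show -(c + s + l) + (c + s' + r) = p by rw [hp]; abel,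
          show -(c + s + l) + (l + (c + s + gridPoint i)) = gridPoint i by abel] at this
      have hpL : p - r ∈ tilingLattice := by
        rw [show p - r = s' - s - l by rw [hp]; abel]
        exact tilingLattice.sub_mem (tilingLattice.sub_mem (hS.mem s' hs') (hS.mem s hs)) (hΛ hl)
      have hpk : IsKagome p := by
        have := (gapVertices_spec r hr).1.add_translation (tilingLattice_le hpL)
        rwa [sub_add_cancel] at this
      have hp3 : 3 < hexNorm p := by
        by_contra hle
        have := eq_of_sub_mem_tilingLattice (Finset.mem_union_left _
          (mem_tileVertices_of_hexNorm_le hpk (not_lt.1 hle))) (Finset.mem_union_right _ hr) hpL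
        exact hle (this ▸ (gapVertices_spec r hr).2)
      obtain ⟨y, hy, e⟩ := exists_mem_outerVertices hpK hp3 (mem_tileVertices.2 ⟨i, hi, rfl⟩)
      refine hmi y hy ?_ ((kagomeAdj_outerVertices_iff hy hi).1 (e ▸ hpK))
      rw [e, (vertexClass_eq_iff (hpk.add_translation (hcs s hs)) hrK).2]
      · exact hd
      · rwa [show c + s' + r - (c + s + p) = l by rw [hp]; abel]

/-- Disjoint damaged tiles contribute a factor of at most 14 each. -/
theorem IsTransversal.indepBetti_biUnion_le (hS : IsTransversal Λ S) (hΛ : Λ ≤ tilingLattice)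
    (hc : c ∈ kagomeTranslations) {m : ℤ × ℤ → ℕ}
    (hm : ∀ s i, (m s).testBit i = true → tileMask.testBit i = true)
    (hB : ∀ s, boundedBy 14 nbrMask [37, 53, 51] 31 (m s) = true) {S' : Finset (ℤ × ℤ)}
    (hS' : S' ⊆ S) :
    indepBetti (hexDimer Λ) (S'.biUnion fun s => bitImage (tileMap Λ c s) (m s)) ≤
      14 ^ S'.card := by
  induction S' using Finset.induction_on with
  | empty => simpa using indepBetti_empty_le (hexDimer Λ)
  | insert s T hs ih =>
    obtain ⟨hsS, hTS⟩ := Finset.insert_subset_iff.1 hS'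
    have hR : ∀ x ∈ T.biUnion fun s => bitImage (tileMap Λ c s) (m s), ∃ t ∈ S, t ≠ s ∧
        ∃ j, tileMask.testBit j = true ∧ tileMap Λ c t j = x := by
      intro x hx
      obtain ⟨t, ht, hx⟩ := Finset.mem_biUnion.1 hx
      obtain ⟨j, hj, rfl⟩ := mem_bitImage.1 hx
      exact ⟨t, hTS ht, fun e => hs (e ▸ ht), j, hm t j hj, rfl⟩
    have hemb : MaskEmbedding (hexDimer Λ) nbrMask tileMask (tileMap Λ c s)
        (T.biUnion fun s => bitImage (tileMap Λ c s) (m s)) := by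
      refine ⟨fun i j hi hj e => gridPoint_injective (hS.eq_of_vertexClass_eq hΛ hc hsS hsS
        (gridPoint_mem_cell hi) (gridPoint_mem_cell hj) e).2, fun i j hi hj => ?_,
        fun i hi hx => ?_, fun i hi x hx ha => ?_⟩
      · rw [hS.adj_tileMap_iff hΛ hc hsS hsS hi hj, eq_self_iff_true, true_and,
          kagomeAdj_gridPoint_iff hi hj]
      · obtain ⟨t, ht, hne, j, hj, e⟩ := hR _ hx
        exact hne (hS.eq_of_vertexClass_eq hΛ hc ht hsS (gridPoint_mem_cell hj)
          (gridPoint_mem_cell hi) e).1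
      · obtain ⟨t, ht, hne, j, hj, rfl⟩ := hR _ hx
        exact hne ((hS.adj_tileMap_iff hΛ hc hsS ht hi hj).1 ha).1.symm
    rw [Finset.biUnion_insert, Finset.card_insert_of_notMem hs, pow_succ']
    exact_mod_cast hemb.indepBetti_le_of_boundedBy (hm s) (hB s)
      (pow_nonneg (by norm_num) T.card) (ih hTS)

/-- Each tile contributes a factor `14`, and each of the 6 gap vertices in its cell a factor `2`. -/
theorem IsTransversal.indepBetti_univ_le (hS : IsTransversal Λ S) (hΛ : Λ ≤ tilingLattice)
    (hc : c ∈ kagomeTranslations) :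
    indepBetti (hexDimer Λ) Finset.univ ≤ 896 ^ S.card := by
  have h := indepBetti_le_two_pow_mul (hexDimer Λ) (gapClasses Λ S c) (B := 14 ^ S.card)
    (by positivity) Finset.univ fun E hE => ?_
  · refine h.trans ?_
    calc (2 : ℤ) ^ (gapClasses Λ S c).card * 14 ^ S.card
        ≤ 2 ^ (S.card * 6) * 14 ^ S.card := by
          gcongr
          · norm_num
          · exact card_gapClasses_le
      _ = 896 ^ S.card := by
          rw [mul_comm S.card 6, pow_mul, ← mul_pow]; norm_num
  · have := fun s : ℤ × ℤ => exists_boundedBy (by norm_num) (by norm_num) _ _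
      allBoundedBy_tileMask
      (fun p => ∃ x ∈ outerVertices, x.2 = p ∧ vertexClass Λ (c + s + x.1) ∈ E)
    choose m hB hm using this
    rw [hS.withoutNbrs_eq_biUnion hΛ hc hE (m := m) fun s i => ?_]
    · exact hS.indepBetti_biUnion_le hΛ hc (fun s i hi => ((hm s i).1 hi).1) hB subset_rfl
    · rw [hm s i]
      refine and_congr_right fun _ => ⟨fun h x hx hxE => ?_, ?_⟩
      · exact h x.2 (List.mem_map_of_mem hx) ⟨x, hx, rfl, hxE⟩
      · rintro h _ - ⟨x, hx, rfl, hxE⟩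
        exact h x hx hxE

end Cells

/-- The base of the bound is the 36th root of `14 * 2 ^ 6`. -/
theorem base_pow : ((14 : ℝ) ^ (1 / 36 : ℝ) * (2 : ℝ) ^ (1 / 6 : ℝ)) ^ 36 = 896 := by
  rw [mul_pow, ← Real.rpow_mul_natCast (by norm_num), ← Real.rpow_mul_natCast (by norm_num)]
  norm_num

end HexDimer

theorem mainTheorem2 :
    (∀ (Λ : AddSubgroup (ℤ × ℤ)), Λ ≤ kagomeTranslations → Tileable Λ →
      ∀ [Finite (HexDimerVertex Λ)] [LinearOrder (HexDimerVertex Λ)],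
        ((hexDimer Λ).independenceComplex.totalBetti : ℝ) ≤
          ((14 : ℝ) ^ (1 / 36 : ℝ) * (2 : ℝ) ^ (1 / 6 : ℝ)) ^ Nat.card (HexDimerVertex Λ)) ∧
    |(14 : ℝ) ^ (1 / 36 : ℝ) * (2 : ℝ) ^ (1 / 6 : ℝ) - 1.21| < 0.005 ∧
    (14 : ℝ) ^ (1 / 36 : ℝ) * (2 : ℝ) ^ (1 / 6 : ℝ) < (2 : ℝ) ^ (1 / 3 : ℝ) := by
  have hpos : 0 ≤ (14 : ℝ) ^ (1 / 36 : ℝ) * (2 : ℝ) ^ (1 / 6 : ℝ) := by positivity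
  have hpow := HexDimer.base_pow
  have hone : 1 ≤ (14 : ℝ) ^ (1 / 36 : ℝ) * (2 : ℝ) ^ (1 / 6 : ℝ) :=
    one_le_mul_of_one_le_of_one_le (Real.one_le_rpow (by norm_num) (by norm_num))
      (Real.one_le_rpow (by norm_num) (by norm_num))
  refine ⟨?_, ?_, ?_⟩
  · intro Λ hΛ hT _ _
    classical
    have := Fintype.ofFinite (HexDimerVertex Λ)
    obtain ⟨c, hc, ht⟩ := hT
    have hL := HexDimer.le_tilingLattice_of_tileable hΛ hc ht
    obtain ⟨S, hS⟩ := HexDimer.exists_isTransversal (Λ := Λ)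
    have hle := hS.indepBetti_univ_le hL hc
    rw [← HexDimer.totalBetti_independenceComplex] at hle
    calc ((hexDimer Λ).independenceComplex.totalBetti : ℝ) ≤ 896 ^ S.card := by exact_mod_cast hle
      _ = ((14 : ℝ) ^ (1 / 36 : ℝ) * (2 : ℝ) ^ (1 / 6 : ℝ)) ^ (S.card * 36) := by
        rw [mul_comm S.card, pow_mul, hpow]
      _ ≤ _ := pow_le_pow_right₀ hone (by
        rw [Nat.card_eq_fintype_card]; exact hS.card_mul_le hL hc)
  · generalize (14 : ℝ) ^ (1 / 36 : ℝ) * (2 : ℝ) ^ (1 / 6 : ℝ) = x at *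
    rw [abs_lt]
    constructor
    · have : (1.205 : ℝ) < x := lt_of_pow_lt_pow_left₀ 36 hpos (by rw [hpow]; norm_num)
      linarith
    · have : x < (1.215 : ℝ) := lt_of_pow_lt_pow_left₀ 36 (by norm_num) (by rw [hpow]; norm_num)
      linarith
  · refine lt_of_pow_lt_pow_left₀ 36 (by positivity) ?_
    rw [hpow, ← Real.rpow_mul_natCast (by norm_num)]
    norm_num
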